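/- All graphs are finite and simple. For a graph $G$, let $\rho(G)$ denote the largest eigenvalue of its adjacency matrix. Write $K_m$ for the complete graph on $m$ vertices, $G\cup H$ for the disjoint union of $G$ and $H$, $mK_1$ for the graph with $m$ vertices and no edges, and $G\nabla H$ for the join of $G$ and $H$, obtained from $G\cup H$ by adding all edges between $V(G)$ and $V(H)$. A graph $G$ is called $k$-factor-critical if $G-S$ has a perfect matching for every $S\subseteq V(G)$ with $|S|=k$. **Theorem.** Let $k\ge 1$ be an integer and let $G$ be a connected graph of order $n$ with minimum degree $\delta\ge k$, where $n\equiv k \pmod 2$ and $$n\ \ge\ \max\{\,8\delta-5k+4,\ \delta(\delta-k)^2+\delta-1\,\}.$$ If $$\rho(G)\ \ge\ \rho\bigl(K_\delta\nabla(K_{n-2\delta+k-1}\cup(\delta-k+1)K_1)\bigr),$$ then $G$ is $k$-factor-critical, unless $G\cong K_\delta\nabla(K_{n-2\delta+k-1}\cup(\delta-k+1)K_1)$. -/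

import Mathlib

/-- The join `G ∇ H`: the disjoint union of `G` and `H` together with all edges between them. -/
def graphJoin {V W : Type*} (G : SimpleGraph V) (H : SimpleGraph W) : SimpleGraph (V ⊕ W) :=
  SimpleGraph.sum G H ⊔ completeBipartiteGraph V W

open Classical in
/-- The largest eigenvalue of the (real, symmetric) adjacency matrix of a finite graph. For a
nonempty vertex set the spectrum is finite and nonempty, so that the supremum is attained; see
`graphSpectralRadius_isGreatest` below. -/
noncomputable def graphSpectralRadius {V : Type*} [Fintype V] (G : SimpleGraph V) : ℝ :=
  sSup (spectrum ℝ (G.adjMatrix ℝ))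

open Classical in
theorem graphSpectralRadius_isGreatest {V : Type*} [Fintype V] [Nonempty V] (G : SimpleGraph V) :
    IsGreatest (spectrum ℝ (G.adjMatrix ℝ)) (graphSpectralRadius G) := by
  have hA : (G.adjMatrix ℝ).IsHermitian := by
    rw [Matrix.IsHermitian, Matrix.conjTranspose_eq_transpose_of_trivial]
    exact SimpleGraph.transpose_adjMatrix (α := ℝ) G
  have hne : (spectrum ℝ (G.adjMatrix ℝ)).Nonempty :=
    ⟨_, hA.eigenvalues_mem_spectrum_real (Classical.arbitrary V)⟩
  have hfin : (spectrum ℝ (G.adjMatrix ℝ)).Finite := Matrix.finite_real_spectrum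
  exact ⟨hne.csSup_mem hfin, fun _ hx => le_csSup hfin.bddAbove hx⟩

/-- `G` is `k`-factor-critical: deleting any `k` vertices leaves a graph with a perfect matching. -/
def IsFactorCritical {V : Type*} (G : SimpleGraph V) (k : ℕ) : Prop :=
  ∀ S : Finset V, S.card = k →
    ∃ M : (G.induce ((S : Set V)ᶜ)).Subgraph, M.IsPerfectMatching

/-- The graph `K_δ ∇ (K_{n-2δ+k-1} ∪ (δ-k+1) K_1)`; the subtractions are genuine ones whenever
`k ≤ δ` and `2δ ≤ n` and `1 ≤ k`. -/
def extremalGraph (n δ k : ℕ) :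
    SimpleGraph (Fin δ ⊕ (Fin (n - 2 * δ + k - 1) ⊕ Fin (δ - k + 1))) :=
  graphJoin (SimpleGraph.completeGraph (Fin δ))
    (SimpleGraph.sum (SimpleGraph.completeGraph (Fin (n - 2 * δ + k - 1)))
      (SimpleGraph.emptyGraph (Fin (δ - k + 1))))

/-! Suppose `G` is not `k`-factor-critical. Tutte's theorem and parity give a set of `s ≥ k`
vertices whose removal leaves at least `s - k + 2` components, each of size at least `max 1 (δ - s +
1)`. By convexity, `G` has most edges when all components but one have this minimal size.

Two elementary bounds turn this into a statement about eigenvalues: Hong's inequality `ρ² ≤ 2m - n +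
1` for `G`, and `ρ ≥ n - δ + k - 2` for the extremal graph, which contains a clique on `n - δ + k -
1` vertices. So an edge count with `2m - n + 1 < (n - δ + k - 2)²` is impossible
(`not_sum_degree_lt`). This excludes `s > δ` and `k < s < δ`.

For `s = δ` and for `s = k < δ` the convex optimum itself is not excluded this way, but every other
size pattern is (`sum_sq_le_or_extremal`). The optimum for `s = δ` puts `G` inside the extremal
graph, and strict monotonicity of `ρ` finishes. The optimum for `s = k` puts `G` inside `K_k ∇
(K_{n-δ-1} ∪ K_{δ-k+1})`, whose radius is smaller by a Perron vector comparison
(`graphSpectralRadius_twoCliqueGraph_lt`). -/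

open Classical in
/-- The quadratic form `xᵀ A x` of the adjacency matrix `A` of `G`. -/
noncomputable def adjForm {V : Type*} [Fintype V] (G : SimpleGraph V) (x : V → ℝ) : ℝ :=
  ∑ u, ∑ w, if G.Adj u w then x u * x w else 0

/-! ### Rayleigh quotients, Perron vectors and Hong's bound -/

section Spectral

variable {V : Type*} [Fintype V]

open Classical in
theorem adjForm_eq_dotProduct (G : SimpleGraph V) (x : V → ℝ) :
    adjForm G x = dotProduct x ((G.adjMatrix ℝ).mulVec x) := by
  simp only [adjForm, dotProduct, Matrix.mulVec, Finset.mul_sum, SimpleGraph.adjMatrix_apply]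
  refine Finset.sum_congr rfl fun u _ => Finset.sum_congr rfl fun w _ => ?_
  split_ifs <;> ring

open Classical in
theorem posSemidef_graphSpectralRadius_sub [Nonempty V] (G : SimpleGraph V) :
    (algebraMap ℝ (Matrix V V ℝ) (graphSpectralRadius G) - G.adjMatrix ℝ).PosSemidef := by
  rw [Matrix.posSemidef_iff_isHermitian_and_spectrum_nonneg]
  constructor
  · refine Matrix.IsHermitian.sub ?_ ?_
    · rw [Matrix.algebraMap_eq_diagonal]
      exact Matrix.isHermitian_diagonal _
    · rw [Matrix.IsHermitian, Matrix.conjTranspose_eq_transpose_of_trivial]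
      exact SimpleGraph.transpose_adjMatrix (α := ℝ) G
  · rw [← spectrum.singleton_sub_eq]
    rintro _ ⟨a, ha, b, hb, rfl⟩
    rw [Set.mem_singleton_iff] at ha
    subst ha
    exact sub_nonneg.2 ((graphSpectralRadius_isGreatest G).2 hb)

open Classical in
theorem dotProduct_graphSpectralRadius_sub (G : SimpleGraph V) (x : V → ℝ) :
    dotProduct x ((algebraMap ℝ (Matrix V V ℝ) (graphSpectralRadius G) -
      G.adjMatrix ℝ).mulVec x) = graphSpectralRadius G * ∑ v, x v ^ 2 - adjForm G x := by
  rw [Matrix.sub_mulVec, dotProduct_sub, adjForm_eq_dotProduct, Algebra.algebraMap_eq_smul_one,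
    Matrix.smul_mulVec, Matrix.one_mulVec, dotProduct_smul, smul_eq_mul, dotProduct]
  simp only [sq]

theorem adjForm_le [Nonempty V] (G : SimpleGraph V) (x : V → ℝ) :
    adjForm G x ≤ graphSpectralRadius G * ∑ v, x v ^ 2 := by
  classical
  have h := (posSemidef_graphSpectralRadius_sub G).dotProduct_mulVec_nonneg x
  rw [star_trivial, dotProduct_graphSpectralRadius_sub] at h
  linarith

-- Equality in the Rayleigh bound makes `x` a zero of the positive semidefinite form of `ρI - A`,
-- hence a kernel vector.
open Classical in
theorem sum_neighbors_of_adjForm_eq [Nonempty V] (G : SimpleGraph V) (x : V → ℝ)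
    (h : adjForm G x = graphSpectralRadius G * ∑ v, x v ^ 2) (v : V) :
    ∑ w, (if G.Adj v w then x w else 0) = graphSpectralRadius G * x v := by
  have h0 := (posSemidef_graphSpectralRadius_sub G).dotProduct_mulVec_zero_iff x
  rw [star_trivial, dotProduct_graphSpectralRadius_sub, h, sub_self] at h0
  have h1 := congrFun (h0.1 rfl) v
  rw [Matrix.sub_mulVec, Algebra.algebraMap_eq_smul_one, Matrix.smul_mulVec,
    Matrix.one_mulVec] at h1
  simp only [Pi.sub_apply, Pi.smul_apply, smul_eq_mul, Pi.zero_apply, Matrix.mulVec, dotProduct,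
    SimpleGraph.adjMatrix_apply, ite_mul, one_mul, zero_mul] at h1
  linarith

open Classical in
/-- Perron–Frobenius: a connected graph has a positive eigenvector for its spectral radius. -/
theorem exists_pos_eigenvector (G : SimpleGraph V) (hG : G.Connected) :
    ∃ x : V → ℝ, (∀ v, 0 < x v) ∧
      (∀ v, ∑ w, (if G.Adj v w then x w else 0) = graphSpectralRadius G * x v) ∧
      adjForm G x = graphSpectralRadius G * ∑ v, x v ^ 2 := by
  have := hG.nonempty
  have hmem := (graphSpectralRadius_isGreatest G).1
  rw [spectrum.mem_iff, Matrix.isUnit_iff_isUnit_det, isUnit_iff_ne_zero, not_not] at hmem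
  obtain ⟨y, hy0, hy⟩ := Matrix.exists_mulVec_eq_zero_iff.2 hmem
  have hyf : adjForm G y = graphSpectralRadius G * ∑ v, y v ^ 2 := by
    have := dotProduct_graphSpectralRadius_sub G y
    rw [hy, dotProduct_zero] at this
    linarith
  -- Taking absolute values keeps the norm and does not decrease the form, so `x` is again a
  -- maximizer and therefore an eigenvector.
  set x : V → ℝ := fun v => |y v| with hx
  have hle : adjForm G y ≤ adjForm G x := by
    refine Finset.sum_le_sum fun u _ => Finset.sum_le_sum fun w _ => ?_
    split_ifs
    · rw [hx]
      simp only
      rw [← abs_mul]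
      exact le_abs_self _
    · exact le_rfl
  have hsq : ∑ v, x v ^ 2 = ∑ v, y v ^ 2 := by simp [hx, sq_abs]
  have hxf : adjForm G x = graphSpectralRadius G * ∑ v, x v ^ 2 := by
    refine le_antisymm (adjForm_le G x) ?_
    rw [hsq, ← hyf]
    exact hle
  have hev := sum_neighbors_of_adjForm_eq G x hxf
  have hnn : ∀ v, 0 ≤ x v := fun v => abs_nonneg _
  -- At a zero entry the nonnegative neighbour entries sum to zero, so zeros spread along edges and,
  -- by connectedness, everywhere.
  have hadj : ∀ u w, G.Adj u w → x u = 0 → x w = 0 := by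
    intro u w huw hu
    have h := hev u
    rw [hu, mul_zero, Finset.sum_eq_zero_iff_of_nonneg] at h
    · simpa [huw] using h w (Finset.mem_univ _)
    · intro i _
      split_ifs
      · exact hnn i
      · exact le_rfl
  have hreach : ∀ u w, G.Reachable u w → x u = 0 → x w = 0 := by
    rintro u w ⟨p⟩
    induction p with
    | nil => exact id
    | cons h _ ih => exact fun hu => ih (hadj _ _ h hu)
  refine ⟨x, fun v => (hnn v).lt_of_ne fun hv => hy0 ?_, hev, hxf⟩
  funext w
  exact abs_eq_zero.1 (hreach v w (hG.preconnected v w) hv.symm)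

theorem adjForm_mono {G H : SimpleGraph V} (h : G ≤ H) {x : V → ℝ} (hx : ∀ v, 0 ≤ x v) :
    adjForm G x ≤ adjForm H x := by
  classical
  refine Finset.sum_le_sum fun u _ => Finset.sum_le_sum fun w _ => ?_
  have := mul_nonneg (hx u) (hx w)
  split_ifs with h1 h2 h2
  · exact le_rfl
  · exact absurd (h h1) h2
  · exact this
  · exact le_rfl

theorem adjForm_strictMono {G H : SimpleGraph V} (h : G < H) {x : V → ℝ} (hx : ∀ v, 0 < x v) :
    adjForm G x < adjForm H x := by
  classical
  obtain ⟨u, w, hH, hG⟩ : ∃ u w, H.Adj u w ∧ ¬ G.Adj u w := by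
    by_contra! hc
    exact h.not_ge fun u w => hc u w
  have hterm : ∀ u w, (if G.Adj u w then x u * x w else 0) ≤
      (if H.Adj u w then x u * x w else 0) := by
    intro u w
    have := (mul_pos (hx u) (hx w)).le
    split_ifs with h1 h2 h2
    · exact le_rfl
    · exact absurd (h.le h1) h2
    · exact this
    · exact le_rfl
  refine Finset.sum_lt_sum (fun u _ => Finset.sum_le_sum fun w _ => hterm u w)
    ⟨u, Finset.mem_univ _, Finset.sum_lt_sum (fun w _ => hterm u w) ⟨w, Finset.mem_univ _, ?_⟩⟩
  rw [if_neg hG, if_pos hH]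
  exact mul_pos (hx u) (hx w)

theorem sum_sq_pos [Nonempty V] {x : V → ℝ} (hx : ∀ v, 0 < x v) : 0 < ∑ v, x v ^ 2 :=
  Finset.sum_pos (fun v _ => pow_pos (hx v) 2) Finset.univ_nonempty

/-- The Perron vector of the smaller graph serves as a test vector for the larger one. -/
theorem graphSpectralRadius_mono {G H : SimpleGraph V} (hG : G.Connected) (h : G ≤ H) :
    graphSpectralRadius G ≤ graphSpectralRadius H := by
  have := hG.nonempty
  obtain ⟨x, hx, -, hf⟩ := exists_pos_eigenvector G hG
  have h1 := adjForm_mono h fun v => (hx v).le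
  have h2 := adjForm_le H x
  rw [hf] at h1
  exact le_of_mul_le_mul_right (h1.trans h2) (sum_sq_pos hx)

theorem graphSpectralRadius_strictMono {G H : SimpleGraph V} (hG : G.Connected) (h : G < H) :
    graphSpectralRadius G < graphSpectralRadius H := by
  have := hG.nonempty
  obtain ⟨x, hx, -, hf⟩ := exists_pos_eigenvector G hG
  have h1 := adjForm_strictMono h hx
  have h2 := adjForm_le H x
  rw [hf] at h1
  exact lt_of_mul_lt_mul_right (h1.trans_le h2) (sum_sq_pos hx).le

theorem adjForm_le_of_iso {W : Type*} [Fintype W] [Nonempty V] {G : SimpleGraph V}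
    {H : SimpleGraph W} (e : G ≃g H) (x : V → ℝ) :
    adjForm G x ≤ graphSpectralRadius H * ∑ v, x v ^ 2 := by
  classical
  have : Nonempty W := Nonempty.map e inferInstance
  have h := adjForm_le H (fun w => x (e.symm w))
  have h1 : ∑ w, x (e.symm w) ^ 2 = ∑ v, x v ^ 2 :=
    Equiv.sum_comp e.symm.toEquiv (fun v => x v ^ 2)
  have h2 : adjForm H (fun w => x (e.symm w)) = adjForm G x := by
    unfold adjForm
    rw [← Equiv.sum_comp e.toEquiv]
    refine Finset.sum_congr rfl fun u _ => ?_
    rw [← Equiv.sum_comp e.toEquiv]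
    refine Finset.sum_congr rfl fun w _ => ?_
    simp only [RelIso.coe_fn_toEquiv, RelIso.symm_apply_apply]
    exact if_congr e.map_adj_iff rfl rfl
  rwa [h1, h2] at h

theorem graphSpectralRadius_le_of_iso {W : Type*} [Fintype W] {G : SimpleGraph V}
    {H : SimpleGraph W} (hG : G.Connected) (e : G ≃g H) :
    graphSpectralRadius G ≤ graphSpectralRadius H := by
  have := hG.nonempty
  obtain ⟨x, hx, -, hf⟩ := exists_pos_eigenvector G hG
  have h := adjForm_le_of_iso e x
  rw [hf] at h
  exact le_of_mul_le_mul_right h (sum_sq_pos hx)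

/-- A clique on `K` forces the spectral radius to be at least `|K| - 1`. -/
theorem card_sub_one_le_graphSpectralRadius (G : SimpleGraph V) (K : Finset V)
    (hK : K.Nonempty) (hcl : ∀ u ∈ K, ∀ w ∈ K, u ≠ w → G.Adj u w) :
    (K.card : ℝ) - 1 ≤ graphSpectralRadius G := by
  classical
  have : Nonempty V := ⟨hK.choose⟩
  have h := adjForm_le G (fun v => if v ∈ K then 1 else 0)
  have h1 : ∑ v, (if v ∈ K then (1 : ℝ) else 0) ^ 2 = K.card := by simp
  have h2 : (K.card : ℝ) * (K.card - 1) ≤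
      adjForm G (fun v => if v ∈ K then (1 : ℝ) else 0) := by
    unfold adjForm
    calc (K.card : ℝ) * (K.card - 1) = ∑ u ∈ K, ∑ w ∈ K.erase u, (1 : ℝ) := by
          rw [Finset.sum_congr rfl (g := fun _ => (K.card : ℝ) - 1)]
          · rw [Finset.sum_const, nsmul_eq_mul]
          · intro u hu
            rw [Finset.sum_const, Finset.card_erase_of_mem hu, nsmul_eq_mul, mul_one,
              Nat.cast_pred (Finset.card_pos.2 hK)]
      _ ≤ ∑ u ∈ K, ∑ w, (if G.Adj u w then
            (if u ∈ K then (1 : ℝ) else 0) * (if w ∈ K then (1 : ℝ) else 0) else 0) := by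
          refine Finset.sum_le_sum fun u hu => ?_
          rw [← Finset.sum_subset (Finset.subset_univ (K.erase u))]
          · refine Finset.sum_le_sum fun w hw => ?_
            rw [Finset.mem_erase] at hw
            simp [hcl u hu w hw.2 hw.1.symm, hu, hw.2]
          · intro w _ hw
            rw [Finset.mem_erase, not_and_or, not_not] at hw
            rcases hw with rfl | hw
            · simp
            · simp [hw]
      _ ≤ _ := by
          refine Finset.sum_le_sum_of_subset_of_nonneg (Finset.subset_univ _) fun u _ _ => ?_
          refine Finset.sum_nonneg fun w _ => ?_
          split_ifs <;> norm_num
  rw [h1] at h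
  have hpos : (0 : ℝ) < K.card := by exact_mod_cast Finset.card_pos.2 hK
  have := h2.trans h
  rw [mul_comm] at this
  exact le_of_mul_le_mul_right this hpos

/-- Hong's bound `ρ(G)² ≤ 2m - n + 1` for connected graphs without isolated vertices. -/
theorem graphSpectralRadius_sq_le (G : SimpleGraph V) [DecidableRel G.Adj] (hG : G.Connected)
    (hd : ∀ v, 1 ≤ G.degree v) :
    graphSpectralRadius G ^ 2 ≤ ∑ v, (G.degree v : ℝ) - Fintype.card V + 1 := by
  classical
  have := hG.nonempty
  obtain ⟨x, hx, hev, -⟩ := exists_pos_eigenvector G hG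
  have hev' : ∀ v, ∑ w ∈ G.neighborFinset v, x w = graphSpectralRadius G * x v := by
    intro v
    rw [← hev v]
    rw [SimpleGraph.neighborFinset_eq_filter, Finset.sum_filter]
    refine Finset.sum_congr rfl fun w _ => ?_
    by_cases hvw : G.Adj v w <;> simp [hvw]
  obtain ⟨i, -, hi⟩ := Finset.exists_max_image Finset.univ x Finset.univ_nonempty
  -- Apply `A` twice at a maximal entry `x i` and bound every entry reached by `x i`.
  have h1 : graphSpectralRadius G ^ 2 * x i ≤ (∑ j ∈ G.neighborFinset i, (G.degree j : ℝ)) * x i := by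
    calc graphSpectralRadius G ^ 2 * x i
        = graphSpectralRadius G * ∑ j ∈ G.neighborFinset i, x j := by rw [hev']; ring
      _ = ∑ j ∈ G.neighborFinset i, ∑ l ∈ G.neighborFinset j, x l := by
          rw [Finset.mul_sum]
          exact Finset.sum_congr rfl fun j _ => (hev' j).symm
      _ ≤ ∑ j ∈ G.neighborFinset i, (G.degree j : ℝ) * x i := by
          refine Finset.sum_le_sum fun j _ => ?_
          rw [← SimpleGraph.card_neighborFinset_eq_degree, ← nsmul_eq_mul]
          exact Finset.sum_le_card_nsmul _ _ _ fun l _ => hi l (Finset.mem_univ _)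
      _ = _ := by rw [Finset.sum_mul]
  refine (le_of_mul_le_mul_right h1 (hx i)).trans ?_
  -- The degrees over the neighbours of `i` are `2m` minus `deg i` minus the degrees of the `n - 1 -
  -- deg i` remaining vertices, each at least 1.
  have h2 := Finset.sum_add_sum_compl (G.neighborFinset i) (fun v => (G.degree v : ℝ))
  have hi' : i ∈ (G.neighborFinset i)ᶜ := by simp
  have h3 := Finset.add_sum_erase _ (fun v => (G.degree v : ℝ)) hi'
  have h4 : (((G.neighborFinset i)ᶜ.erase i).card : ℝ) ≤
      ∑ v ∈ (G.neighborFinset i)ᶜ.erase i, (G.degree v : ℝ) := by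
    have := Finset.card_nsmul_le_sum ((G.neighborFinset i)ᶜ.erase i)
      (fun v => (G.degree v : ℝ)) 1 fun v _ => by exact_mod_cast hd v
    simpa using this
  have h5 : ((G.neighborFinset i)ᶜ.erase i).card + 1 + G.degree i = Fintype.card V := by
    rw [Finset.card_erase_add_one hi', ← SimpleGraph.card_neighborFinset_eq_degree,
      Finset.card_compl_add_card]
  have h6 : (((G.neighborFinset i)ᶜ.erase i).card : ℝ) + 1 + G.degree i = Fintype.card V := by
    exact_mod_cast h5
  linarith

end Spectral

-- The separating set from Tutte's theorem

universe u

open Classical in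
/-- If `G` is not `k`-factor-critical, then by Tutte's theorem there is a vertex set (the fibre of
`f` over `none`) of some size `s ≥ k` whose removal leaves at least `s - k + 2` components
(the fibres of `f` over `some i`). -/
theorem exists_separation_of_not_isFactorCritical {V : Type u} [Fintype V] (G : SimpleGraph V)
    (k : ℕ) (hpar : Fintype.card V ≡ k [MOD 2]) (h : ¬ IsFactorCritical G k) :
    ∃ (ι : Type u) (_ : Fintype ι) (f : V → Option ι),
      (∀ i, ∃ v, f v = some i) ∧
      (∀ u v, G.Adj u v → f u = none ∨ f v = none ∨ f u = f v) ∧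
      k ≤ (Finset.univ.filter fun v => f v = none).card ∧
      (Finset.univ.filter fun v => f v = none).card + 2 ≤ Fintype.card ι + k := by
  unfold IsFactorCritical at h
  push Not at h
  obtain ⟨S, hS, hM⟩ := h
  have hT := (not_congr (SimpleGraph.tutte (G := G.induce ((S : Set V)ᶜ)))).1 (by simpa using hM)
  push Not at hT
  obtain ⟨T, hT⟩ := hT
  unfold SimpleGraph.IsTutteViolator at hT
  set D := (⊤ : (G.induce ((S : Set V)ᶜ)).Subgraph).deleteVerts T with hD
  have hmem : ∀ x : ((S : Set V)ᶜ : Set V), x ∈ D.verts ↔ x ∉ T := by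
    intro x
    simp [hD]
  have hadj : ∀ x y : D.verts, G.Adj x.1.1 y.1.1 → D.coe.Adj x y := by
    intro x y hxy
    have hx := (hmem _).1 x.2
    have hy := (hmem _).1 y.2
    simp only [hD, SimpleGraph.Subgraph.coe_adj, SimpleGraph.Subgraph.deleteVerts_adj]
    exact ⟨trivial, hx, trivial, hy, hxy⟩
  -- The number of odd components has the parity of `|V| - k - |T|`, that is, of `|T|`; exceeding
  -- `|T|` it is at least `|T| + 2`. The separator is `S ∪ T`, of size `k + |T|`.
  have hpar2 := SimpleGraph.odd_ncard_oddComponents D.coe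
  have hcardS : Nat.card ((S : Set V)ᶜ : Set V) + k = Fintype.card V := by
    rw [← hS, ← Set.ncard_coe_finset, add_comm, ← Nat.card_eq_fintype_card]
    exact Set.ncard_add_ncard_compl _
  have hcardD : Nat.card D.verts + T.ncard = Nat.card ((S : Set V)ᶜ : Set V) := by
    have : D.verts = Tᶜ := by
      ext x
      rw [hmem]
      rfl
    rw [this, add_comm]
    exact Set.ncard_add_ncard_compl _
  have hle : D.coe.oddComponents.ncard ≤ Fintype.card D.coe.ConnectedComponent := by
    rw [← Nat.card_eq_fintype_card]
    exact Set.ncard_le_card _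
  let f : V → Option D.coe.ConnectedComponent := fun v =>
    if hv : v ∈ ((S : Set V)ᶜ : Set V) then
      if hv' : (⟨v, hv⟩ : ((S : Set V)ᶜ : Set V)) ∈ D.verts then
        some (D.coe.connectedComponentMk ⟨⟨v, hv⟩, hv'⟩) else none
    else none
  have hf : ∀ x : D.verts, f x.1.1 = some (D.coe.connectedComponentMk x) := by
    intro x
    simp only [f]
    rw [dif_pos x.1.2, dif_pos x.2]
  have hf' : ∀ v, f v ≠ none → ∃ x : D.verts, x.1.1 = v := by
    intro v hv
    simp only [f] at hv
    split_ifs at hv with h1 h2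
    · exact ⟨⟨⟨v, h1⟩, h2⟩, rfl⟩
    · exact absurd rfl hv
    · exact absurd rfl hv
  have hcount : (Finset.univ.filter fun v => f v = none).card + Nat.card D.verts =
      Fintype.card V := by
    have h1 : (Finset.univ.filter fun v => ¬ f v = none) =
        Finset.univ.image (fun x : D.verts => x.1.1) := by
      ext v
      simp only [Finset.mem_filter, Finset.mem_univ, true_and, Finset.mem_image]
      constructor
      · exact hf' v
      · rintro ⟨x, rfl⟩
        rw [hf]
        exact Option.some_ne_none _
    have h2 : (Finset.univ.filter fun v => ¬ f v = none).card = Nat.card D.verts := by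
      rw [h1, Finset.card_image_of_injective, Finset.card_univ, Nat.card_eq_fintype_card]
      exact Subtype.val_injective.comp Subtype.val_injective
    rw [← h2, Finset.card_filter_add_card_filter_not, Finset.card_univ]
  refine ⟨D.coe.ConnectedComponent, inferInstance, f, ?_, ?_, by omega, ?_⟩
  · intro i
    induction i using SimpleGraph.ConnectedComponent.ind with
    | _ x => exact ⟨x.1.1, hf x⟩
  · intro u v huv
    by_contra! hc
    obtain ⟨x, rfl⟩ := hf' u hc.1
    obtain ⟨y, rfl⟩ := hf' v hc.2.1
    rw [hf, hf] at hc
    exact hc.2.2 (congrArg some (SimpleGraph.ConnectedComponent.sound (hadj x y huv).reachable))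
  · rw [Nat.odd_iff, Nat.odd_iff] at hpar2
    unfold Nat.ModEq at hpar
    omega

/-! ### Convexity of component sizes -/

section Sizes

variable {ι : Type*}

/-- Convexity: a family of at least `q` integers, each at least `a`, with sum `(q - 1) a + L` has
sum of squares at most `(q - 1) a² + L²`. -/
theorem sum_sq_le_of_le (s : Finset ι) (m : ι → ℤ) (a L q : ℤ) (ha : 0 ≤ a)
    (hm : ∀ i ∈ s, a ≤ m i) (hq : q ≤ s.card) (hL : a ≤ L)
    (hsum : ∑ i ∈ s, m i = (q - 1) * a + L) :
    ∑ i ∈ s, m i ^ 2 ≤ (q - 1) * a ^ 2 + L ^ 2 := by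
  classical
  have hmL : ∀ i ∈ s, m i ≤ L := by
    intro i hi
    have h1 := Finset.add_sum_erase s m hi
    have h2 := Finset.card_nsmul_le_sum (s.erase i) m a fun j hj => hm j (Finset.mem_of_mem_erase hj)
    rw [Finset.card_erase_of_mem hi, nsmul_eq_mul,
      Nat.cast_pred (Finset.card_pos.2 ⟨i, hi⟩)] at h2
    nlinarith
  -- On `[a, L]` the square lies below its chord: `(m i - a) * (L - m i) ≥ 0`.
  have h3 : ∑ i ∈ s, m i ^ 2 ≤ ∑ i ∈ s, ((a + L) * m i - a * L) := by
    refine Finset.sum_le_sum fun i hi => ?_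
    nlinarith [mul_nonneg (sub_nonneg.2 (hm i hi)) (sub_nonneg.2 (hmL i hi))]
  rw [Finset.sum_sub_distrib, ← Finset.mul_sum, hsum, Finset.sum_const, nsmul_eq_mul] at h3
  nlinarith [mul_nonneg (sub_nonneg.2 hq) (mul_nonneg ha (ha.trans hL))]

/-- Stability of `sum_sq_le_of_le`: away from the extremal configuration the bound improves. -/
theorem sum_sq_le_or_extremal (s : Finset ι) (m : ι → ℤ) (a L q : ℤ) (ha : 1 ≤ a)
    (hm : ∀ i ∈ s, a ≤ m i) (hq2 : 2 ≤ q) (hq : q ≤ s.card) (hL : a + 1 ≤ L)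
    (hsum : ∑ i ∈ s, m i = (q - 1) * a + L) :
    ∑ i ∈ s, m i ^ 2 ≤ (q - 2) * a ^ 2 + (a + 1) ^ 2 + (L - 1) ^ 2 ∨
      ((s.card : ℤ) = q ∧ ∃ i ∈ s, m i = L ∧ ∀ j ∈ s, j ≠ i → m j = a) := by
  classical
  have hne : s.Nonempty := Finset.card_pos.1 (by omega)
  obtain ⟨i, hi, hmax⟩ := Finset.exists_max_image s m hne
  have h1 := Finset.add_sum_erase s m hi
  have h2 := Finset.add_sum_erase s (fun j => m j ^ 2) hi
  have hcard : ((s.erase i).card : ℤ) = s.card - 1 := by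
    rw [Finset.card_erase_of_mem hi, Nat.cast_pred (Finset.card_pos.2 hne)]
  have hm' : ∀ j ∈ s.erase i, a ≤ m j := fun j hj => hm j (Finset.mem_of_mem_erase hj)
  rcases le_or_gt L (m i) with hLi | hLi
  -- A part of size at least `L` leaves at most `(q - 1) * a` for the others, which forces their
  -- number and sizes.
  · right
    have h3 : ∑ j ∈ s.erase i, (m j - a) = ∑ j ∈ s.erase i, m j - (s.card - 1) * a := by
      rw [Finset.sum_sub_distrib, Finset.sum_const, nsmul_eq_mul, hcard]
    have h4 : 0 ≤ ∑ j ∈ s.erase i, (m j - a) :=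
      Finset.sum_nonneg fun j hj => sub_nonneg.2 (hm' j hj)
    have h5 : (s.card - q : ℤ) * a ≤ 0 := by nlinarith
    have h6 : (s.card : ℤ) = q := by nlinarith
    have h7 : ∑ j ∈ s.erase i, (m j - a) = 0 := by
      rw [h6] at h3
      linarith
    refine ⟨h6, i, hi, by rw [h6] at h3; linarith, fun j hj hji => ?_⟩
    have := (Finset.sum_eq_zero_iff_of_nonneg fun j hj => sub_nonneg.2 (hm' j hj)).1 h7 j
      (Finset.mem_erase.2 ⟨hji, hj⟩)
    linarith
  · left
    rcases eq_or_lt_of_le (hm i hi) with hia | hia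
    -- The maximum is `a`, so all parts are equal.
    · have h3 : ∀ j ∈ s, m j ^ 2 = a * m j := by
        intro j hj
        have : m j = a := le_antisymm (hia ▸ hmax j hj) (hm j hj)
        rw [this, sq]
      rw [Finset.sum_congr rfl h3, ← Finset.mul_sum, hsum]
      rcases eq_or_lt_of_le hL with h | h
      · subst h
        nlinarith
      · nlinarith [mul_nonneg (show 0 ≤ L by omega) (show 0 ≤ L - 2 - a by omega)]
    -- Set the largest part aside: `m i` and `L + a - m i` have sum `L + a` and both lie in `[a + 1,
    -- L - 1]`, so their squares are at most those of the two ends.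
    · have h3 := sum_sq_le_of_le (s.erase i) m a (L + a - m i) (q - 1) (by omega) hm'
        (by omega) (by omega) (by linarith)
      have h4 : 0 ≤ (m i - (a + 1)) * (L - 1 - m i) :=
        mul_nonneg (by omega) (by omega)
      nlinarith

end Sizes

/-! ### Degree sum of a separated graph -/

section DegreeSum

variable {V ι : Type*} [Fintype V]

open Classical in
/-- The fibre of `f` over `o`. -/
noncomputable def fiberFinset (f : V → Option ι) (o : Option ι) : Finset V :=
  Finset.univ.filter fun v => f v = o

theorem mem_fiberFinset {f : V → Option ι} {o : Option ι} {v : V} :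
    v ∈ fiberFinset f o ↔ f v = o := by
  simp [fiberFinset]

theorem degree_lt_of_separation (G : SimpleGraph V) [DecidableRel G.Adj] (f : V → Option ι)
    (hf : ∀ u v, G.Adj u v → f u = none ∨ f v = none ∨ f u = f v) {v : V} {i : ι}
    (hv : f v = some i) :
    G.degree v + 1 ≤ (fiberFinset f none).card + (fiberFinset f (some i)).card := by
  classical
  rw [← SimpleGraph.card_neighborFinset_eq_degree, ← Finset.card_insert_of_notMem (a := v) (by simp)]
  refine (Finset.card_le_card ?_).trans (Finset.card_union_le _ _)
  intro w hw
  rw [Finset.mem_union, mem_fiberFinset, mem_fiberFinset]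
  rw [Finset.mem_insert, SimpleGraph.mem_neighborFinset] at hw
  rcases hw with rfl | hw
  · exact Or.inr hv
  · have := hf v w hw
    rw [hv] at this
    rcases this with h | h | h
    · exact absurd h (Option.some_ne_none _)
    · exact Or.inl h
    · exact Or.inr h.symm

variable [Fintype ι]

theorem card_fiberFinset_none_add_sum (f : V → Option ι) :
    (fiberFinset f none).card + ∑ i, (fiberFinset f (some i)).card = Fintype.card V := by
  classical
  rw [← Fintype.sum_option (fun o => (fiberFinset f o).card), ← Finset.card_univ]
  exact (Finset.card_eq_sum_card_fiberwise fun v _ => Finset.mem_univ (f v)).symm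

/-- The right-hand side is the degree sum when the separator is joined to everything and each
component is a clique: degrees `n - 1` and `s + m_i - 1`. -/
theorem sum_degree_le_of_separation (G : SimpleGraph V) [DecidableRel G.Adj] (f : V → Option ι)
    (hf : ∀ u v, G.Adj u v → f u = none ∨ f v = none ∨ f u = f v) :
    ∑ v, (G.degree v : ℤ) ≤ (fiberFinset f none).card * ((Fintype.card V : ℤ) - 1) +
      (Fintype.card V - (fiberFinset f none).card) * ((fiberFinset f none).card - 1) +
      ∑ i, ((fiberFinset f (some i)).card : ℤ) ^ 2 := by
  classical
  have h0 : ∑ v, (G.degree v : ℤ) = ∑ o, ∑ v ∈ fiberFinset f o, (G.degree v : ℤ) :=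
    (Finset.sum_fiberwise_of_maps_to (fun v _ => Finset.mem_univ (f v)) _).symm
  rw [h0, Fintype.sum_option]
  have h1 : ∑ v ∈ fiberFinset f none, (G.degree v : ℤ) ≤
      (fiberFinset f none).card * ((Fintype.card V : ℤ) - 1) := by
    rw [← nsmul_eq_mul]
    refine Finset.sum_le_card_nsmul _ _ _ fun v _ => ?_
    have := G.degree_lt_card_verts v
    omega
  have h2 : ∀ i ∈ Finset.univ, ∑ v ∈ fiberFinset f (some i), (G.degree v : ℤ) ≤
      ((fiberFinset f (some i)).card : ℤ) * ((fiberFinset f none).card - 1) +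
        ((fiberFinset f (some i)).card : ℤ) ^ 2 := by
    intro i _
    have : ∑ v ∈ fiberFinset f (some i), (G.degree v : ℤ) ≤ (fiberFinset f (some i)).card •
        (((fiberFinset f none).card : ℤ) + (fiberFinset f (some i)).card - 1) := by
      refine Finset.sum_le_card_nsmul _ _ _ fun v hv => ?_
      have := degree_lt_of_separation G f hf (mem_fiberFinset.1 hv)
      omega
    rw [nsmul_eq_mul] at this
    linarith
  have h3 := Finset.sum_le_sum h2
  rw [Finset.sum_add_distrib, ← Finset.sum_mul] at h3
  have h4 : (∑ i, ((fiberFinset f (some i)).card : ℤ)) =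
      Fintype.card V - (fiberFinset f none).card := by
    have := card_fiberFinset_none_add_sum f
    rw [← this]
    push_cast
    ring
  rw [h4] at h3
  linarith

end DegreeSum

/-! ### Numerical estimates against the squared clique bound -/

section Estimates

/-- The left side is convex in `s`, so only the ends `s = δ + 1` and `2s = n + k - 2` matter. The
slack at the first is the quantity in `hf1`, and four times the slack at the second is that in
`hf2`; the bound `8δ - 5k + 4` makes the second factor in `hf2` nonnegative. -/
theorem edge_estimate_of_lt {n δ k s : ℤ} (hk : 1 ≤ k) (hkδ : k ≤ δ) (hs : δ < s)
    (hn1 : 8 * δ - 5 * k + 4 ≤ n) (hn2 : δ * (δ - k) ^ 2 + δ - 1 ≤ n) (hsn : 2 * s - k + 2 ≤ n) :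
    s * (n - 1) + (n - s) * (s - 1) + ((s - k + 1) * 1 ^ 2 + (n - s - (s - k + 1) * 1) ^ 2) - n + 1 <
      (n - δ + k - 2) ^ 2 := by
  have hf1 : 0 < 2 * n - (δ - k) - 3 - 2 * (δ + 1) * (δ - k + 2) := by
    obtain ⟨j, rfl⟩ : ∃ j, δ = k + j := ⟨δ - k, by ring⟩
    have hj : 0 ≤ j := by linarith
    rw [add_sub_cancel_left] at *
    rcases (by omega : j = 0 ∨ j = 1 ∨ j = 2 ∨ 3 ≤ j) with rfl | rfl | rfl | h
    · linarith
    · linarith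
    · rcases le_or_gt k 6 with h | h <;> omega
    · nlinarith [mul_nonneg (show 0 ≤ k + j by linarith) (mul_nonneg (sub_nonneg.2 h) hj)]
  have hf2 : 0 < (n + k - 2) * ((n + k - 2) - 8 * δ + 4 * k - 2) + 4 * δ ^ 2 - 4 * k + 4 := by
    have : 0 ≤ (n + k - 2) * ((n + k - 2) - 8 * δ + 4 * k - 2) :=
      mul_nonneg (by linarith) (by linarith)
    nlinarith
  by_contra! hc
  have hu : 0 ≤ s - (δ + 1) := by linarith
  have hw : 0 ≤ n + k - 2 - 2 * s := by linarith
  have hd : 0 ≤ n + k - 2 - 2 * (δ + 1) := by linarith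
  have h1 := mul_nonneg hd (mul_nonneg hu hw)
  have h2 := mul_nonneg hu hf2.le
  have h3 := mul_nonneg hw hf1.le
  have h4 := mul_nonneg hd (sub_nonneg.2 hc)
  rcases eq_or_lt_of_le hu with h | h
  · have : s = δ + 1 := by linarith
    subst this
    nlinarith
  · have h5 := mul_pos h hf2
    nlinarith

/-- With `p = s - k` and `r = δ - s`, expanding reduces the claim to `key`, where `n` has
coefficient `2pr`. Since `(p + 1)(r + 1) ≤ 4pr`, the factor `pr` can be cancelled and the cubic
bound on `n` suffices. -/
theorem edge_estimate_of_between {n δ k s : ℤ} (hk : 1 ≤ k) (hks : k < s) (hs : s < δ)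
    (hn2 : δ * (δ - k) ^ 2 + δ - 1 ≤ n) :
    s * (n - 1) + (n - s) * (s - 1) + ((s - k + 1) * (δ - s + 1) ^ 2 +
      (n - s - (s - k + 1) * (δ - s + 1)) ^ 2) - n + 1 < (n - δ + k - 2) ^ 2 := by
  obtain ⟨p, rfl⟩ : ∃ p, s = k + p := ⟨s - k, by ring⟩
  obtain ⟨r, rfl⟩ : ∃ r, δ = k + p + r := ⟨δ - (k + p), by ring⟩
  have hp : 1 ≤ p := by linarith
  have hr : 1 ≤ r := by linarith
  have key : (p * r) ^ 2 + p * r + (p + 1) * (r + 1) * (2 * (k + p) + r) <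
      2 * (p * r) * (n - (p + r + 1)) + (p + r + 1) := by
    have hx : 1 ≤ p * r := by nlinarith
    have hn3 : (k + p + r) * (p + r) ^ 2 + (k + p + r) - 1 ≤ n := by
      have : k + p + r - k = p + r := by ring
      rwa [this] at hn2
    have h1 := mul_le_mul_of_nonneg_left hn3 (show 0 ≤ 2 * (p * r) by linarith)
    have h2 : (p + 1) * (r + 1) ≤ 4 * (p * r) := by
      nlinarith [mul_nonneg (sub_nonneg.2 hp) (sub_nonneg.2 hr)]
    have h3 : (p + 1) * (r + 1) * (2 * (k + p) + r) ≤ 4 * (p * r) * (2 * (k + p + r) - r) := by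
      have : 2 * (k + p) + r = 2 * (k + p + r) - r := by ring
      rw [this]
      exact mul_le_mul_of_nonneg_right h2 (by linarith)
    have h4 : 4 * (p * r) ≤ (p + r) ^ 2 := by nlinarith [sq_nonneg (p - r)]
    suffices h : (p * r) ^ 2 + p * r + 4 * (p * r) * (2 * (k + p + r) - r) <
        2 * (p * r) * ((k + p + r) * (p + r) ^ 2 + (k + p + r) - 1) - 2 * (p * r) * (p + r + 1)
          + (p + r + 1) by linarith
    suffices h : p * r * (p * r + 1 + 8 * (k + p + r) - 4 * r) ≤
        p * r * (2 * ((k + p + r) * (p + r) ^ 2 + (k + p + r) - 1) - 2 * (p + r + 1)) by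
      nlinarith
    refine mul_le_mul_of_nonneg_left ?_ (by linarith)
    rcases eq_or_lt_of_le (show 2 ≤ p + r by linarith) with h | h
    · have hp1 : p = 1 := by linarith
      have hr1 : r = 1 := by linarith
      subst hp1 hr1
      nlinarith
    · have h5 : 0 ≤ (p + r) ^ 2 - 9 := by nlinarith
      have h6 : 0 ≤ (k + p + r - 4) * ((p + r) ^ 2 - 4) :=
        mul_nonneg (by linarith) (by linarith)
      nlinarith
  nlinarith

/-- The case `s = δ` at the runner-up sizes: singletons, one component of size 2, and the rest. -/
theorem edge_estimate_of_eq {n δ k : ℤ} (hk : 1 ≤ k) (hkδ : k ≤ δ)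
    (hn1 : 8 * δ - 5 * k + 4 ≤ n) (hn2 : δ * (δ - k) ^ 2 + δ - 1 ≤ n) :
    δ * (n - 1) + (n - δ) * (δ - 1) + ((δ - k + 2 - 2) * 1 ^ 2 + (1 + 1) ^ 2 +
      (n - δ - (δ - k + 1) * 1 - 1) ^ 2) - n + 1 < (n - δ + k - 2) ^ 2 := by
  obtain ⟨j, rfl⟩ : ∃ j, δ = k + j := ⟨δ - k, by ring⟩
  have hj : 0 ≤ j := by linarith
  rw [add_sub_cancel_left] at hn2
  have key : 2 * (k + j) * (j + 2) + 3 * (j + 1) + 4 < 2 * n := by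
    rcases (by omega : j = 0 ∨ j = 1 ∨ j = 2 ∨ 3 ≤ j) with rfl | rfl | rfl | h
    · linarith
    · linarith
    · rcases le_or_gt k 5 with h | h <;> omega
    · nlinarith [mul_nonneg (show 0 ≤ k + j by linarith) (mul_nonneg (sub_nonneg.2 h) hj)]
  nlinarith

/-- The case `s = k` at the runner-up sizes: two components, the smaller of size `δ - k + 2`. -/
theorem edge_estimate_of_eq_of_lt {n δ k : ℤ} (hk : 1 ≤ k) (hkδ : k < δ)
    (hn1 : 8 * δ - 5 * k + 4 ≤ n) (hn2 : δ * (δ - k) ^ 2 + δ - 1 ≤ n) :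
    k * (n - 1) + (n - k) * (k - 1) + ((2 - 2) * (δ - k + 1) ^ 2 + (δ - k + 1 + 1) ^ 2 +
      (n - k - (δ - k + 1) - 1) ^ 2) - n + 1 < (n - δ + k - 2) ^ 2 := by
  obtain ⟨j, rfl⟩ : ∃ j, δ = k + j := ⟨δ - k, by ring⟩
  have hj : 1 ≤ j := by linarith
  rw [add_sub_cancel_left] at *
  have key : (j + 2) * (2 * k + j + 1) + j + 3 < 2 * n := by
    rcases (by omega : j = 1 ∨ j = 2 ∨ 3 ≤ j) with rfl | rfl | h
    · linarith
    · linarith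
    · nlinarith [mul_nonneg (show 0 ≤ k + j by linarith) (mul_nonneg (sub_nonneg.2 h) (by linarith : 0 ≤ j))]
  nlinarith

end Estimates

/-! ### The extremal graph and its competitor -/

section Extremal

variable {V : Type*} [Fintype V]

/-- The graph in which `Z` is independent, `V ∖ Z` is a clique, and `A` is joined to everything. -/
def splitGraph (A Z : Finset V) : SimpleGraph V where
  Adj u w := u ≠ w ∧ (u ∈ A ∨ w ∈ A ∨ (u ∉ Z ∧ w ∉ Z))
  symm := ⟨fun _ _ h => ⟨h.1.symm, by tauto⟩⟩
  loopless := ⟨fun _ h => h.1 rfl⟩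

theorem nonempty_splitGraph_iso (A Z : Finset V) (hAZ : Disjoint A Z) {n δ k : ℕ} (hk : 1 ≤ k)
    (hkδ : k ≤ δ) (hn2 : 2 * δ ≤ n) (hn : Fintype.card V = n) (hA : A.card = δ) (hZ : Z.card = δ - k + 1) :
    Nonempty (splitGraph A Z ≃g extremalGraph n δ k) := by
  classical
  have hB : ((A ∪ Z)ᶜ).card = n - 2 * δ + k - 1 := by
    rw [Finset.card_compl, Finset.card_union_of_disjoint hAZ, hn, hA, hZ]
    omega
  let eA := Finset.equivFinOfCardEq hA
  let eB := Finset.equivFinOfCardEq hB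
  let eZ := Finset.equivFinOfCardEq hZ
  let g : Fin δ ⊕ (Fin (n - 2 * δ + k - 1) ⊕ Fin (δ - k + 1)) → V :=
    Sum.elim (fun i => (eA.symm i).1)
      (Sum.elim (fun i => (eB.symm i).1) (fun i => (eZ.symm i).1))
  have hgA : ∀ i, g (Sum.inl i) ∈ A := fun i => (eA.symm i).2
  have hgB : ∀ i, g (Sum.inr (Sum.inl i)) ∈ (A ∪ Z)ᶜ := fun i => (eB.symm i).2
  have hgZ : ∀ i, g (Sum.inr (Sum.inr i)) ∈ Z := fun i => (eZ.symm i).2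
  have hgA' : ∀ i, g (Sum.inl i) ∉ Z := fun i => Finset.disjoint_left.1 hAZ (hgA i)
  have hgZ' : ∀ i, g (Sum.inr (Sum.inr i)) ∉ A := fun i => Finset.disjoint_right.1 hAZ (hgZ i)
  have hgB' : ∀ i, g (Sum.inr (Sum.inl i)) ∉ A ∧ g (Sum.inr (Sum.inl i)) ∉ Z := by
    intro i
    have := hgB i
    rw [Finset.mem_compl, Finset.mem_union, not_or] at this
    exact this
  have hinj : Function.Injective g := by
    rintro (i | i | i) (j | j | j) h
    · exact congrArg _ (eA.symm.injective (Subtype.ext h))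
    · exact absurd (h ▸ hgA i) (hgB' j).1
    · exact absurd (h ▸ hgA i) (hgZ' j)
    · exact absurd (h ▸ hgA j) (hgB' i).1
    · exact congrArg _ (congrArg _ (eB.symm.injective (Subtype.ext h)))
    · exact absurd (h ▸ hgZ j) (hgB' i).2
    · exact absurd (h ▸ hgA j) (hgZ' i)
    · exact absurd (h ▸ hgZ i) (hgB' j).2
    · exact congrArg _ (congrArg _ (eZ.symm.injective (Subtype.ext h)))
  have hbij : Function.Bijective g := by
    rw [Fintype.bijective_iff_injective_and_card]
    refine ⟨hinj, ?_⟩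
    simp only [Fintype.card_sum, Fintype.card_fin]
    omega
  refine ⟨SimpleGraph.Iso.symm ⟨Equiv.ofBijective g hbij, ?_⟩⟩
  intro a b
  simp only [Equiv.ofBijective_apply, splitGraph, extremalGraph, graphJoin, ne_eq, hinj.eq_iff]
  rcases a with i | i | i <;> rcases b with j | j | j <;>
    simp [hgA, hgA', hgZ, hgZ', hgB', Sum.inl.injEq, Sum.inr.injEq]

/-- `K_δ` together with the large clique is a clique on `n - δ + k - 1` vertices. -/
theorem le_graphSpectralRadius_extremalGraph {n δ k : ℕ} (hk : 1 ≤ k) (hkδ : k ≤ δ)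
    (hn2 : 2 * δ ≤ n) :
    (n : ℝ) - δ + k - 2 ≤ graphSpectralRadius (extremalGraph n δ k) := by
  have h := card_sub_one_le_graphSpectralRadius (extremalGraph n δ k)
    (Finset.univ.disjSum (Finset.univ.disjSum ∅))
    ⟨Sum.inl ⟨0, by omega⟩, by simp⟩ (by
      rintro (i | i | i) hi (j | j | j) hj hij <;>
        simp_all [extremalGraph, graphJoin])
  simp only [Finset.card_disjSum, Finset.card_univ, Fintype.card_fin, Finset.card_empty] at h
  have h1 : δ + (n - 2 * δ + k - 1 + 0) + δ + 1 = n + k := by omega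
  have h2 : ((δ + (n - 2 * δ + k - 1 + 0) : ℕ) : ℝ) + δ + 1 = n + k := by exact_mod_cast h1
  linarith

/-- The graph `K_X ∇ (K_Y ∪ K_{V ∖ (X ∪ Y)})`. -/
def twoCliqueGraph (X Y : Finset V) : SimpleGraph V where
  Adj u w := u ≠ w ∧ (u ∈ X ∨ w ∈ X ∨ (u ∈ Y ↔ w ∈ Y))
  symm := ⟨fun _ _ h => ⟨h.1.symm, by tauto⟩⟩
  loopless := ⟨fun _ h => h.1 rfl⟩

/-- Passing from `K_X ∇ (K_Y ∪ K_Z)` to the split graph with centre `X ∪ D` gains the edges between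
`Z` and `D` and loses those inside `Z`. -/
theorem adjForm_twoCliqueGraph_add_le [DecidableEq V] (X Y D : Finset V) (hXY : Disjoint X Y)
    (hDY : D ⊆ Y) {x : V → ℝ} (hx : ∀ v, 0 ≤ x v) :
    adjForm (twoCliqueGraph X Y) x + (2 * (∑ w ∈ (X ∪ Y)ᶜ, x w) * (∑ w ∈ D, x w) -
      (∑ w ∈ (X ∪ Y)ᶜ, x w) ^ 2) ≤ adjForm (splitGraph (X ∪ D) (X ∪ Y)ᶜ) x := by
  classical
  have hind : ∀ P : Finset V, ∑ w, (if w ∈ P then x w else 0) = ∑ w ∈ P, x w := fun P => by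
    rw [← Finset.sum_filter]
    simp
  -- As a double sum of indicators the change can be compared entry by entry. Only the diagonal of
  -- `Z × Z`, subtracted without being an edge, makes it an inequality.
  have hrw : 2 * (∑ w ∈ (X ∪ Y)ᶜ, x w) * (∑ w ∈ D, x w) - (∑ w ∈ (X ∪ Y)ᶜ, x w) ^ 2 =
      ∑ u, ∑ w, ((if u ∈ (X ∪ Y)ᶜ then x u else 0) * (if w ∈ D then x w else 0) +
        (if u ∈ D then x u else 0) * (if w ∈ (X ∪ Y)ᶜ then x w else 0) -
        (if u ∈ (X ∪ Y)ᶜ then x u else 0) * (if w ∈ (X ∪ Y)ᶜ then x w else 0)) := by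
    simp only [Finset.sum_sub_distrib, Finset.sum_add_distrib, ← Finset.mul_sum,
      ← Finset.sum_mul, hind]
    ring
  rw [hrw]
  unfold adjForm
  rw [← Finset.sum_add_distrib]
  refine Finset.sum_le_sum fun u _ => ?_
  rw [← Finset.sum_add_distrib]
  refine Finset.sum_le_sum fun w _ => ?_
  have huw := mul_nonneg (hx u) (hx w)
  have hcls : ∀ v, (v ∈ X ∧ v ∉ Y ∧ v ∉ D) ∨ (v ∉ X ∧ v ∈ Y ∧ v ∈ D) ∨
      (v ∉ X ∧ v ∈ Y ∧ v ∉ D) ∨ (v ∉ X ∧ v ∉ Y ∧ v ∉ D) := by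
    intro v
    have h1 : v ∈ D → v ∈ Y := fun h => hDY h
    have h2 : v ∈ Y → v ∉ X := fun h => Finset.disjoint_right.1 hXY h
    tauto
  simp only [twoCliqueGraph, splitGraph, Finset.mem_compl, Finset.mem_union]
  by_cases hne : u = w
  · subst hne
    rcases hcls u with h | h | h | h <;> simp [h] <;> nlinarith
  · rcases hcls u with h | h | h | h <;> rcases hcls w with h' | h' | h' | h' <;>
      simp [h, h', hne]

/-- The Perron vector is constant on each clique, with value `y` on `Y` and a smaller `z` on the
smaller clique `Z`. With `j = δ - k = |D|`, rewiring to the split graph gains `2(j+1)z · jy` and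
loses at most `((j+1)z)²`; the gain wins because `2j ≥ j + 1`. -/
theorem graphSpectralRadius_twoCliqueGraph_lt (X Y : Finset V) (hXY : Disjoint X Y)
    (hcon : (twoCliqueGraph X Y).Connected) {n δ k : ℕ} (hk : 1 ≤ k) (hkδ : k < δ)
    (hn2 : 2 * δ ≤ n) (hn : Fintype.card V = n) (hX : X.card = k)
    (hY : Y.card + k + (δ - k + 1) = n) (hlt : δ - k + 1 < Y.card) :
    graphSpectralRadius (twoCliqueGraph X Y) < graphSpectralRadius (extremalGraph n δ k) := by
  classical
  have := hcon.nonempty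
  obtain ⟨x, hx, hev, hform⟩ := exists_pos_eigenvector _ hcon
  set H := twoCliqueGraph X Y with hH
  set ρ := graphSpectralRadius H
  set Z : Finset V := (X ∪ Y)ᶜ with hZdef
  have hmemZ : ∀ v, v ∈ Z ↔ v ∉ X ∧ v ∉ Y := fun v => by
    rw [hZdef, Finset.mem_compl, Finset.mem_union, not_or]
  have hZ : Z.card = δ - k + 1 := by
    rw [hZdef, Finset.card_compl, Finset.card_union_of_disjoint hXY, hn, hX]
    omega
  have hXpos : 0 < ∑ w ∈ X, x w :=
    Finset.sum_pos (fun w _ => hx w) (Finset.card_pos.1 (by omega))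
  -- Adding `x v` to the eigenvalue equation gives the sum over the closed neighbourhood, which is
  -- `X ∪ Y` for every `v` in `Y`.
  have hsumY : ∀ v ∈ Y, (ρ + 1) * x v = ∑ w ∈ X, x w + ∑ w ∈ Y, x w := by
    intro v hv
    rw [← Finset.sum_union hXY, add_mul, one_mul, ← hev v, ← Finset.sum_filter,
      ← Finset.sum_erase_add (X ∪ Y) x (Finset.mem_union_right _ hv)]
    congr 1
    refine Finset.sum_congr ?_ fun _ _ => rfl
    ext w
    have := Finset.disjoint_right.1 hXY hv
    simp only [hH, twoCliqueGraph, Finset.mem_filter, Finset.mem_univ, true_and,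
      Finset.mem_erase, Finset.mem_union]
    tauto
  have hXZ : Disjoint X Z := Finset.disjoint_left.2 fun v hv h => ((hmemZ v).1 h).1 hv
  have hsumZ : ∀ v ∈ Z, (ρ + 1) * x v = ∑ w ∈ X, x w + ∑ w ∈ Z, x w := by
    intro v hv
    rw [← Finset.sum_union hXZ, add_mul, one_mul, ← hev v, ← Finset.sum_filter,
      ← Finset.sum_erase_add (X ∪ Z) x (Finset.mem_union_right _ hv)]
    congr 1
    refine Finset.sum_congr ?_ fun _ _ => rfl
    ext w
    rw [hmemZ] at hv
    simp only [hH, twoCliqueGraph, Finset.mem_filter, Finset.mem_univ, true_and,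
      Finset.mem_erase, Finset.mem_union, hmemZ]
    tauto
  obtain ⟨v₀, hv₀⟩ : Y.Nonempty := Finset.card_pos.1 (by omega)
  obtain ⟨w₀, hw₀⟩ : Z.Nonempty := Finset.card_pos.1 (by omega)
  have hρ1 : ρ + 1 ≠ 0 := by
    intro h0
    have := hsumY v₀ hv₀
    rw [h0, zero_mul] at this
    have h' : 0 ≤ ∑ w ∈ Y, x w := Finset.sum_nonneg fun w _ => (hx w).le
    linarith
  set y := x v₀
  set z := x w₀
  have hyc : ∀ v ∈ Y, x v = y := fun v hv =>
    mul_left_cancel₀ hρ1 ((hsumY v hv).trans (hsumY v₀ hv₀).symm)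
  have hzc : ∀ v ∈ Z, x v = z := fun v hv =>
    mul_left_cancel₀ hρ1 ((hsumZ v hv).trans (hsumZ w₀ hw₀).symm)
  have hy0 : 0 < y := hx _
  have hz0 : 0 < z := hx _
  have hYsum : ∀ D ⊆ Y, ∑ w ∈ D, x w = D.card * y := fun D hD => by
    rw [Finset.sum_congr rfl fun w hw => hyc w (hD hw), Finset.sum_const, nsmul_eq_mul]
  have hZsum : ∑ w ∈ Z, x w = Z.card * z := by
    rw [Finset.sum_congr rfl hzc, Finset.sum_const, nsmul_eq_mul]
  -- Both `(ρ + 1 - |Y|) y` and `(ρ + 1 - |Z|) z` equal the positive sum over `X`.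
  have hyz : z < y := by
    have h1 := hsumY v₀ hv₀
    have h2 := hsumZ w₀ hw₀
    rw [hYsum Y subset_rfl] at h1
    rw [hZsum] at h2
    have h3 : (Z.card : ℝ) < Y.card := by
      rw [hZ]
      exact_mod_cast hlt
    have h4 : 0 < ρ + 1 - Y.card := by
      by_contra! h
      nlinarith
    by_contra! h
    have h5 : (ρ + 1 - Y.card) * y ≤ (ρ + 1 - Y.card) * z := mul_le_mul_of_nonneg_left h h4.le
    nlinarith
  obtain ⟨D, hDY, hD⟩ := Finset.exists_subset_card_eq (s := Y) (n := δ - k) (by omega)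
  have hXD : Disjoint X D := Finset.disjoint_of_subset_right hDY hXY
  have hZD : Disjoint Z D := Finset.disjoint_left.2 fun v hv h => ((hmemZ v).1 hv).2 (hDY h)
  obtain ⟨e⟩ := nonempty_splitGraph_iso (X ∪ D) Z
    (Finset.disjoint_union_left.2 ⟨hXZ, hZD.symm⟩) hk hkδ.le hn2 hn
    (by rw [Finset.card_union_of_disjoint hXD]; omega) hZ
  have hE := adjForm_le_of_iso e x
  have hdiff := adjForm_twoCliqueGraph_add_le X Y D hXY hDY fun v => (hx v).le
  have hpos : 0 < 2 * (∑ w ∈ Z, x w) * (∑ w ∈ D, x w) - (∑ w ∈ Z, x w) ^ 2 := by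
    rw [hZsum, hYsum D hDY, hZ, hD]
    have h1 : ((δ - k : ℕ) : ℝ) ≥ 1 := by exact_mod_cast (by omega : 1 ≤ δ - k)
    push_cast
    set j : ℝ := ((δ - k : ℕ) : ℝ)
    have h2 : 0 < 2 * (j * y) - (j + 1) * z := by nlinarith
    have h3 : 0 < (j + 1) * z := by positivity
    nlinarith [mul_pos h3 h2]
  rw [hform] at hdiff
  exact lt_of_mul_lt_mul_right (by linarith) (sum_sq_pos hx).le

end Extremal

/-! ### The contradiction, by the size of the separator -/

/-- Any edge count that keeps Hong's bound below the clique number of the extremal graph is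
incompatible with a large spectral radius. -/
theorem not_sum_degree_lt {V : Type*} [Fintype V] (G : SimpleGraph V) [DecidableRel G.Adj]
    {n δ k : ℕ} (hn : Fintype.card V = n) (hd : ∀ v, δ ≤ G.degree v) (hG : G.Connected)
    (hk : 1 ≤ k) (hkδ : k ≤ δ) (hn2 : 2 * δ ≤ n)
    (hρ : graphSpectralRadius (extremalGraph n δ k) ≤ graphSpectralRadius G) :
    ¬ ∑ v, (G.degree v : ℤ) - n + 1 < ((n : ℤ) - δ + k - 2) ^ 2 := by
  intro hlt
  have h1 := graphSpectralRadius_sq_le G hG fun v => (hk.trans hkδ).trans (hd v)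
  have h2 := (le_graphSpectralRadius_extremalGraph hk hkδ hn2).trans hρ
  have h3 : ∑ v, (G.degree v : ℝ) - n + 1 < ((n : ℝ) - δ + k - 2) ^ 2 := by exact_mod_cast hlt
  have h4 : (0 : ℝ) ≤ (n : ℝ) - δ + k - 2 := by
    have h5 : 2 * (δ : ℝ) ≤ n := by exact_mod_cast hn2
    have h6 : (1 : ℝ) ≤ k := by exact_mod_cast hk
    have h7 : (k : ℝ) ≤ δ := by exact_mod_cast hkδ
    linarith
  rw [hn] at h1
  have h5 := pow_le_pow_left₀ h4 h2 2
  linarith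

theorem mainTheorem6 {V : Type*} [Fintype V] (G : SimpleGraph V) [DecidableRel G.Adj]
    (n δ k : ℕ) (hn : Fintype.card V = n) (hδ : G.minDegree = δ) (hG : G.Connected)
    (hk : 1 ≤ k) (hkδ : k ≤ δ) (hpar : n ≡ k [MOD 2])
    (hbound : max (8 * (δ : ℤ) - 5 * (k : ℤ) + 4)
      ((δ : ℤ) * ((δ : ℤ) - (k : ℤ)) ^ 2 + (δ : ℤ) - 1) ≤ (n : ℤ))
    (hρ : graphSpectralRadius (extremalGraph n δ k) ≤ graphSpectralRadius G)
    (hne : ¬ Nonempty (G ≃g extremalGraph n δ k)) :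
    IsFactorCritical G k := by
  classical
  by_contra hcrit
  obtain ⟨hb1, hb2⟩ := max_le_iff.1 hbound
  have hd : ∀ v, δ ≤ G.degree v := fun v => hδ ▸ G.minDegree_le_degree v
  have hn2 : 2 * δ ≤ n := by omega
  have hk' : (1 : ℤ) ≤ k := by exact_mod_cast hk
  have hkδ' : (k : ℤ) ≤ δ := by exact_mod_cast hkδ
  obtain ⟨ι, _, f, hsurj, hf, hs, hc⟩ :=
    exists_separation_of_not_isFactorCritical G k (hn ▸ hpar) hcrit
  have hnot := not_sum_degree_lt G hn hd hG hk hkδ hn2 hρ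
  have hdeg := sum_degree_le_of_separation G f hf
  have hcard := card_fiberFinset_none_add_sum f
  have hfn : (Finset.univ.filter fun v => f v = none) = fiberFinset f none := by
    ext v
    simp [mem_fiberFinset]
  rw [hfn] at hs hc
  rw [hn] at hdeg hcard
  set s := (fiberFinset f none).card with hsdef
  have hm1 : ∀ i ∈ (Finset.univ : Finset ι), (1 : ℤ) ≤ (fiberFinset f (some i)).card := by
    intro i _
    obtain ⟨v, hv⟩ := hsurj i
    have : 0 < (fiberFinset f (some i)).card := Finset.card_pos.2 ⟨v, mem_fiberFinset.2 hv⟩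
    omega
  have hm2 : ∀ i ∈ (Finset.univ : Finset ι),
      (δ : ℤ) - s + 1 ≤ (fiberFinset f (some i)).card := by
    intro i _
    obtain ⟨v, hv⟩ := hsurj i
    have h1 := degree_lt_of_separation G f hf hv
    have h2 := hd v
    omega
  have hsum : ∑ i, ((fiberFinset f (some i)).card : ℤ) = n - s := by
    rw [← hcard]
    push_cast
    ring
  have hq : (s : ℤ) - k + 2 ≤ (Finset.univ : Finset ι).card := by
    rw [Finset.card_univ]
    omega
  have hs' : (k : ℤ) ≤ s := by exact_mod_cast hs
  -- Ensures that the one large component left by the convexity bound still has size at least `a`.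
  have hlow : ∀ a : ℤ, 0 ≤ a →
      (∀ i ∈ (Finset.univ : Finset ι), a ≤ (fiberFinset f (some i)).card) →
      ((s : ℤ) - k + 2) * a ≤ n - s := by
    intro a ha ham
    have h1 := Finset.card_nsmul_le_sum _ _ a ham
    rw [hsum, nsmul_eq_mul] at h1
    exact (mul_le_mul_of_nonneg_right hq ha).trans h1
  rcases lt_trichotomy s δ with hsδ | hsδ | hsδ
  · rcases eq_or_lt_of_le hs with hks | hks
    · have hsk : (s : ℤ) = k := by exact_mod_cast hks.symm
      rw [hsk] at hm2 hsum hq hdeg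
      have hkδ2 : (k : ℤ) < δ := by omega
      rcases sum_sq_le_or_extremal Finset.univ (fun i => ((fiberFinset f (some i)).card : ℤ))
        ((δ : ℤ) - k + 1) (n - k - (δ - k + 1)) 2 (by omega) hm2 le_rfl (by linarith)
        (by omega) (by rw [hsum]; ring) with h | ⟨hc2, i, -, hi, hj⟩
      · have := edge_estimate_of_eq_of_lt hk' hkδ2 hb1 hb2
        exact hnot (by linarith)
      -- Exactly two components, of sizes `n - δ - 1` and `δ - k + 1`; `some i` labels the large
      -- one.
      · have hXY : Disjoint (fiberFinset f none) (fiberFinset f (some i)) := by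
          refine Finset.disjoint_left.2 fun v hv hv' => ?_
          rw [mem_fiberFinset] at hv hv'
          rw [hv] at hv'
          exact Option.some_ne_none _ hv'.symm
        have hle : G ≤ twoCliqueGraph (fiberFinset f none) (fiberFinset f (some i)) := by
          intro u w huw
          refine ⟨huw.ne, ?_⟩
          simp only [mem_fiberFinset]
          rcases hf u w huw with h | h | h
          · exact Or.inl h
          · exact Or.inr (Or.inl h)
          · exact Or.inr (Or.inr (by rw [h]))
        have hlt := graphSpectralRadius_twoCliqueGraph_lt _ _ hXY (hG.mono hle) hk
          (by omega) hn2 hn (hsdef ▸ hks.symm) (by omega) (by omega)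
        exact absurd (hρ.trans (graphSpectralRadius_mono hG hle)) hlt.not_ge
    · have h1 := sum_sq_le_of_le Finset.univ (fun i => ((fiberFinset f (some i)).card : ℤ))
        ((δ : ℤ) - s + 1) (n - s - (s - k + 1) * (δ - s + 1)) (s - k + 2) (by omega) hm2 hq
        (by have := hlow _ (by omega) hm2; linarith) (by rw [hsum]; ring)
      have h2 := edge_estimate_of_between (s := s) hk' (by exact_mod_cast hks)
        (by exact_mod_cast hsδ) hb2
      have h3 : (s : ℤ) - k + 2 - 1 = s - k + 1 := by ring
      rw [h3] at h1
      exact hnot (by linarith)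
  · rw [hsδ] at hsum hq hdeg
    rcases sum_sq_le_or_extremal Finset.univ (fun i => ((fiberFinset f (some i)).card : ℤ))
      1 (n - δ - (δ - k + 1) * 1) (δ - k + 2) le_rfl hm1 (by omega) hq
      (by omega) (by rw [hsum]; ring) with h | ⟨hc2, i, -, hi, hj⟩
    · have := edge_estimate_of_eq hk' hkδ' hb1 hb2
      exact hnot (by linarith)
    -- All components but `Y` are singletons, so the vertices outside `A ∪ Y` are independent and
    -- `G` lies in a copy of the extremal graph.
    · set A := fiberFinset f none
      set Y := fiberFinset f (some i)
      have hAY : Disjoint A Y := by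
        refine Finset.disjoint_left.2 fun v hv hv' => ?_
        rw [mem_fiberFinset] at hv hv'
        rw [hv] at hv'
        exact Option.some_ne_none _ hv'.symm
      have hZ : ((A ∪ Y)ᶜ).card = δ - k + 1 := by
        rw [Finset.card_compl, Finset.card_union_of_disjoint hAY, hn]
        omega
      obtain ⟨e⟩ := nonempty_splitGraph_iso A (A ∪ Y)ᶜ
        (Finset.disjoint_left.2 fun v hv h =>
          (Finset.mem_compl.1 h) (Finset.mem_union_left _ hv)) hk hkδ hn2 hn hsδ hZ
      have hle : G ≤ splitGraph A (A ∪ Y)ᶜ := by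
        intro u w huw
        refine ⟨huw.ne, ?_⟩
        simp only [Finset.mem_compl, Finset.mem_union, not_not]
        by_cases hu : u ∈ A
        · exact Or.inl hu
        by_cases hw : w ∈ A
        · exact Or.inr (Or.inl hw)
        refine Or.inr (Or.inr ?_)
        have huw' : f u = f w := by
          rcases hf u w huw with h | h | h
          · exact absurd (mem_fiberFinset.2 h) hu
          · exact absurd (mem_fiberFinset.2 h) hw
          · exact h
        obtain ⟨l, hl⟩ := Option.ne_none_iff_exists'.1 fun h => hu (mem_fiberFinset.2 h)
        by_cases hli : l = i
        · subst hli
          exact ⟨Or.inr (mem_fiberFinset.2 hl), Or.inr (mem_fiberFinset.2 (huw' ▸ hl))⟩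
        · have h1 : (fiberFinset f (some l)).card = 1 := by
            exact_mod_cast hj l (Finset.mem_univ _) hli
          exact absurd (Finset.card_le_one.1 h1.le u (mem_fiberFinset.2 hl) w
            (mem_fiberFinset.2 (huw' ▸ hl))) huw.ne
      have hneq : G ≠ splitGraph A (A ∪ Y)ᶜ := fun h => hne (h ▸ ⟨e⟩)
      have h1 := graphSpectralRadius_strictMono hG (lt_of_le_of_ne hle hneq)
      have h2 := graphSpectralRadius_le_of_iso (hG.mono hle) e
      linarith
  · have h0 := hlow 1 (by omega) hm1
    have h1 := sum_sq_le_of_le Finset.univ (fun i => ((fiberFinset f (some i)).card : ℤ))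
      1 (n - s - (s - k + 1) * 1) (s - k + 2) (by omega) hm1 hq (by linarith)
      (by rw [hsum]; ring)
    have h2 := edge_estimate_of_lt (s := s) hk' hkδ' (by exact_mod_cast hsδ) hb1 hb2
      (by linarith)
    have h3 : (s : ℤ) - k + 2 - 1 = s - k + 1 := by ring
    rw [h3] at h1
    exact hnot (by linarith)
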